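/- Let $d,r\ge 1$ be integers. Let $H^2=H^2(\mathbb C^d)$ be the Drury--Arveson space (the symmetric Fock space over $\mathbb C^d$), that is, the Hilbert space of power series $f=\sum_{n\in\mathbb N^d}a_nz^n$ in $z=(z_1,\dots,z_d)$ with $$\|f\|^2=\sum_{n}\frac{n_1!\cdots n_d!}{(n_1+\dots+n_d)!}\,|a_n|^2<\infty .$$ Let $S_1,\dots,S_d$ be the $d$-shift of rank $r$, i.e. the bounded operators on $H^2\otimes\mathbb C^r$ determined by $S_k(f\otimes\zeta)=z_kf\otimes\zeta$ for $f\in H^2$, $\zeta\in\mathbb C^r$. A monomial in $H^2\otimes\mathbb C^r$ is an element of the form $z^n\otimes\zeta$ with $n\in\mathbb N^d$ and $\zeta\in\mathbb C^r$. Let $M\subseteq H^2\otimes\mathbb C^r$ be a closed subspace, invariant under $S_1,\dots,S_d$, that is generated as an invariant subspace by some (arbitrary, possibly infinite) set $G$ of monomials; that is, $M$ is the smallest closed subspace that contains $G$ and is invariant under $S_1,\dots,S_d$. Let $P_M$ be the orthogonal projection of $H^2\otimes\mathbb C^r$ onto $M$. Then for every real $p>2d$ and every $k=1,\dots,d$,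 $$P_MS_k-S_kP_M\in\mathcal L^p ,$$ where $\mathcal L^p$ is the Schatten--von Neumann class of all compact operators $T$ whose list of singular values (the square roots of the nonzero eigenvalues of $T^*T$, repeated according to multiplicity) is $p$-summable. -/

import Mathlib

namespace DruryArveson

open scoped TensorProduct InnerProductSpace ComplexConjugate

noncomputable section

/-- The weight `n! / |n|!` of a multi-index `n`, where `n! = n₁! ⋯ n_d!` and `|n| = n₁ + ⋯ + n_d`.
It is the square of the norm of the monomial `z ^ n` in the Drury-Arveson space. -/
def weight {d : ℕ} (n : Fin d →₀ ℕ) : ℝ :=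
  (∏ i, (Nat.factorial (n i) : ℝ)) / (Nat.factorial n.degree : ℝ)

lemma weight_pos {d : ℕ} (n : Fin d →₀ ℕ) : 0 < weight n := by
  unfold weight
  have h : ∀ m : ℕ, (0 : ℝ) < (Nat.factorial m : ℝ) := fun m => by
    exact_mod_cast Nat.factorial_pos m
  exact div_pos (Finset.prod_pos fun i _ => h _) (h _)

lemma weight_add_single {d : ℕ} (n : Fin d →₀ ℕ) (k : Fin d) :
    weight (n + Finsupp.single k 1) = ((n k : ℝ) + 1) / ((n.degree : ℝ) + 1) * weight n := by
  unfold weight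
  have h1 : (n + Finsupp.single k 1).degree = n.degree + 1 := by simp
  have h2 : (∏ i, (Nat.factorial ((n + Finsupp.single k 1 : Fin d →₀ ℕ) i) : ℝ))
      = ((n k : ℝ) + 1) * ∏ i, (Nat.factorial (n i) : ℝ) := by
    rw [← Finset.mul_prod_erase _ _ (Finset.mem_univ k),
      ← Finset.mul_prod_erase (a := k) _ (fun i => (Nat.factorial (n i) : ℝ)) (Finset.mem_univ k),
      ← mul_assoc]
    congr 1
    · simp [Nat.factorial_succ]
    · refine Finset.prod_congr rfl fun i hi => ?_
      have : k ≠ i := (Finset.ne_of_mem_erase hi).symm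
      simp [this]
  rw [h1, h2, Nat.factorial_succ]
  push_cast
  have : (Nat.factorial n.degree : ℝ) ≠ 0 := by exact_mod_cast Nat.factorial_ne_zero _
  field_simp

lemma weight_add_single_le {d : ℕ} (n : Fin d →₀ ℕ) (k : Fin d) :
    weight (n + Finsupp.single k 1) ≤ weight n := by
  rw [weight_add_single]
  have hk : (n k : ℝ) ≤ n.degree := by exact_mod_cast Finsupp.le_degree k n
  have : ((n k : ℝ) + 1) / ((n.degree : ℝ) + 1) ≤ 1 := by
    rw [div_le_one (by positivity)]
    linarith
  exact mul_le_of_le_one_left (weight_pos n).le this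

/-- The Drury-Arveson space `H²(ℂ^d)` (the symmetric Fock space over `ℂ^d`), as the space of
power series `f = ∑ aₙ z ^ n` in `d` variables with `∑ (n! / |n|!) ‖aₙ‖ ^ 2 < ∞`. Such a series
converges in the open unit ball of `ℂ^d`, to a holomorphic function that determines it; the
resulting reproducing kernel is `∑ (|n|! / n!) z ^ n conj(w) ^ n = 1 / (1 - ⟨z, w⟩)`. -/
def H2 (d : ℕ) : Submodule ℂ (MvPowerSeries (Fin d) ℂ) where
  carrier := {f | Summable fun n => weight n * ‖MvPowerSeries.coeff n f‖ ^ 2}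
  zero_mem' := by simp [summable_zero]
  add_mem' {f g} hf hg := by
    refine Summable.of_nonneg_of_le
      (fun n => mul_nonneg (weight_pos n).le (sq_nonneg _)) (fun n => ?_)
      ((Summable.add hf hg).mul_left 2)
    have h := norm_add_le (MvPowerSeries.coeff n f) (MvPowerSeries.coeff n g)
    have h' : ‖MvPowerSeries.coeff n (f + g)‖ ^ 2
        ≤ 2 * (‖MvPowerSeries.coeff n f‖ ^ 2 + ‖MvPowerSeries.coeff n g‖ ^ 2) := by
      rw [map_add]
      nlinarith [norm_nonneg (MvPowerSeries.coeff n f + MvPowerSeries.coeff n g),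
        sq_nonneg (‖MvPowerSeries.coeff n f‖ - ‖MvPowerSeries.coeff n g‖)]
    nlinarith [mul_le_mul_of_nonneg_left h' (weight_pos n).le]
  smul_mem' c f hf := by
    have h := Summable.mul_left (‖c‖ ^ 2) hf
    refine h.congr fun n => ?_
    rw [MvPowerSeries.coeff_smul, norm_mul]
    ring

lemma mem_H2 {d : ℕ} (f : MvPowerSeries (Fin d) ℂ) :
    f ∈ H2 d ↔ Summable fun n => weight n * ‖MvPowerSeries.coeff n f‖ ^ 2 := Iff.rfl

lemma summable_inner {d : ℕ} (f g : H2 d) : Summable fun n =>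
    (weight n : ℂ) * (conj (MvPowerSeries.coeff n f.1) * MvPowerSeries.coeff n g.1) := by
  refine Summable.of_norm_bounded (Summable.add f.2 g.2) fun n => ?_
  rw [norm_mul, norm_mul, RCLike.norm_conj, Complex.norm_real, Real.norm_eq_abs,
    abs_of_pos (weight_pos n), ← mul_add]
  refine mul_le_mul_of_nonneg_left ?_ (weight_pos n).le
  nlinarith [sq_nonneg (‖MvPowerSeries.coeff n f.1‖ - ‖MvPowerSeries.coeff n g.1‖),
    sq_nonneg (‖MvPowerSeries.coeff n f.1‖), sq_nonneg (‖MvPowerSeries.coeff n g.1‖)]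

lemma tsum_inner_self {d : ℕ} (f : H2 d) :
    ∑' n, (weight n : ℂ) * (conj (MvPowerSeries.coeff n f.1) * MvPowerSeries.coeff n f.1) =
      ((∑' n, weight n * ‖MvPowerSeries.coeff n f.1‖ ^ 2 : ℝ) : ℂ) := by
  rw [Complex.ofReal_tsum]
  refine tsum_congr fun n => ?_
  rw [Complex.conj_mul']
  push_cast
  rfl

/-- The inner product `⟪f, g⟫ = ∑ (n! / |n|!) conj(aₙ) bₙ` of `f = ∑ aₙ z ^ n` and
`g = ∑ bₙ z ^ n` (conjugate-linear in the first variable, as everywhere in Mathlib). -/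
@[reducible] def core (d : ℕ) : InnerProductSpace.Core ℂ (H2 d) where
  inner f g := ∑' n, (weight n : ℂ) *
    (conj (MvPowerSeries.coeff n f.1) * MvPowerSeries.coeff n g.1)
  conj_inner_symm f g := by
    rw [Complex.conj_tsum]
    refine tsum_congr fun n => ?_
    simp only [map_mul, Complex.conj_ofReal, Complex.conj_conj]
    ring
  re_inner_nonneg f := by
    rw [tsum_inner_self]
    exact tsum_nonneg fun n => mul_nonneg (weight_pos n).le (sq_nonneg _)
  add_left f g h := by
    rw [← (summable_inner f h).tsum_add (summable_inner g h)]
    refine tsum_congr fun n => ?_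
    simp only [Submodule.coe_add, map_add]
    ring
  smul_left f g c := by
    rw [← tsum_mul_left]
    refine tsum_congr fun n => ?_
    simp only [Submodule.coe_smul, MvPowerSeries.coeff_smul, map_mul]
    ring
  definite f hf := by
    rw [tsum_inner_self, Complex.ofReal_eq_zero] at hf
    have h0 := (hasSum_zero_iff_of_nonneg
      (fun n => mul_nonneg (weight_pos n).le (sq_nonneg _))).1 (hf ▸ Summable.hasSum f.2)
    refine Subtype.ext (MvPowerSeries.ext fun n => ?_)
    have := congrFun h0 n
    simpa [(weight_pos n).ne'] using this

instance instNormedAddCommGroup (d : ℕ) : NormedAddCommGroup (H2 d) :=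
  @InnerProductSpace.Core.toNormedAddCommGroup ℂ (H2 d) _ _ _ (core d)

instance instInnerProductSpace (d : ℕ) : InnerProductSpace ℂ (H2 d) :=
  InnerProductSpace.ofCore (core d).toCore

lemma inner_def {d : ℕ} (f g : H2 d) : ⟪f, g⟫_ℂ = ∑' n, (weight n : ℂ) *
    (conj (MvPowerSeries.coeff n f.1) * MvPowerSeries.coeff n g.1) := rfl

lemma norm_sq_eq {d : ℕ} (f : H2 d) :
    ‖f‖ ^ 2 = ∑' n, weight n * ‖MvPowerSeries.coeff n f.1‖ ^ 2 := by
  have h : ⟪f, f⟫_ℂ = ((‖f‖ ^ 2 : ℝ) : ℂ) := by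
    rw [inner_self_eq_norm_sq_to_K]
    push_cast
    rfl
  rw [inner_def, tsum_inner_self] at h
  exact_mod_cast h.symm

/-- Rescaling the coefficients identifies `H²(ℂ^d)` with `ℓ²`; used for completeness. -/
def toLp (d : ℕ) : H2 d ≃ₗᵢ[ℂ] lp (fun _ : Fin d →₀ ℕ => ℂ) 2 where
  toFun f := ⟨fun n => (√(weight n) : ℂ) * MvPowerSeries.coeff n f.1, by
    refine memℓp_gen (Summable.congr f.2 fun n => ?_)
    simp [mul_pow, Real.sq_sqrt (weight_pos n).le]⟩
  invFun a := ⟨fun n => (√(weight n) : ℂ)⁻¹ * a n, by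
    have h := (memℓp_gen_iff (by norm_num)).1 (lp.memℓp a)
    refine (Summable.congr h fun n => ?_)
    change _ = weight n * ‖(√(weight n) : ℂ)⁻¹ * a n‖ ^ 2
    have := (weight_pos n).ne'
    simp [mul_pow, Real.sq_sqrt (weight_pos n).le, this]⟩
  left_inv f := by
    refine Subtype.ext (MvPowerSeries.ext fun n => ?_)
    have : (√(weight n) : ℂ) ≠ 0 := by
      exact_mod_cast (Real.sqrt_pos.2 (weight_pos n)).ne'
    change (√(weight n) : ℂ)⁻¹ * ((√(weight n) : ℂ) * MvPowerSeries.coeff n f.1) = _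
    field_simp
  right_inv a := by
    refine lp.ext (funext fun n => ?_)
    have : (√(weight n) : ℂ) ≠ 0 := by
      exact_mod_cast (Real.sqrt_pos.2 (weight_pos n)).ne'
    change (√(weight n) : ℂ) * ((√(weight n) : ℂ)⁻¹ * a n) = _
    field_simp
  map_add' f g := by
    refine lp.ext (funext fun n => ?_)
    exact (congrArg _ (map_add _ _ _)).trans (mul_add _ _ _)
  map_smul' c f := by
    refine lp.ext (funext fun n => ?_)
    simp [mul_left_comm]
  norm_map' f := by
    rw [← sq_eq_sq₀ (norm_nonneg _) (norm_nonneg _), norm_sq_eq]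
    have := lp.norm_rpow_eq_tsum (p := 2) (by norm_num)
      (⟨fun n => (√(weight n) : ℂ) * MvPowerSeries.coeff n f.1, by
        refine memℓp_gen (Summable.congr f.2 fun n => ?_)
        simp [mul_pow, Real.sq_sqrt (weight_pos n).le]⟩ : lp (fun _ : Fin d →₀ ℕ => ℂ) 2)
    simp only [ENNReal.toReal_ofNat, Real.rpow_ofNat] at this
    refine this.trans (tsum_congr fun n => ?_)
    simp [mul_pow, Real.sq_sqrt (weight_pos n).le]

instance instCompleteSpace (d : ℕ) : CompleteSpace (H2 d) :=
  (completeSpace_congr (e := (toLp d).toEquiv) (toLp d).isometry.isUniformEmbedding).2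
    inferInstance

lemma coeff_add_single_X_mul {d : ℕ} (k : Fin d) (f : MvPowerSeries (Fin d) ℂ)
    (n : Fin d →₀ ℕ) :
    MvPowerSeries.coeff (n + Finsupp.single k 1) (MvPowerSeries.X k * f)
      = MvPowerSeries.coeff n f := by
  rw [add_comm, MvPowerSeries.X, MvPowerSeries.coeff_add_monomial_mul, one_mul]

lemma coeff_X_mul_of_notMem_range {d : ℕ} (k : Fin d) (f : MvPowerSeries (Fin d) ℂ)
    (n : Fin d →₀ ℕ) (hn : n ∉ Set.range fun m : Fin d →₀ ℕ => m + Finsupp.single k 1) :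
    MvPowerSeries.coeff n (MvPowerSeries.X k * f) = 0 := by
  classical
  rw [MvPowerSeries.X, MvPowerSeries.coeff_monomial_mul, if_neg]
  intro h
  exact hn ⟨n - Finsupp.single k 1, tsub_add_cancel_of_le h⟩

lemma add_single_injective {d : ℕ} (k : Fin d) :
    Function.Injective fun m : Fin d →₀ ℕ => m + Finsupp.single k 1 :=
  fun _ _ h => add_right_cancel h

lemma support_X_mul {d : ℕ} (k : Fin d) (f : MvPowerSeries (Fin d) ℂ) :
    (Function.support fun n => weight n *
        ‖MvPowerSeries.coeff n (MvPowerSeries.X k * f)‖ ^ 2)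
      ⊆ Set.range fun m : Fin d →₀ ℕ => m + Finsupp.single k 1 := by
  intro n hn
  by_contra h
  exact hn (by simp [coeff_X_mul_of_notMem_range k f n h])

lemma summable_shift {d : ℕ} (k : Fin d) (f : H2 d) : Summable fun m : Fin d →₀ ℕ =>
    weight (m + Finsupp.single k 1) * ‖MvPowerSeries.coeff m f.1‖ ^ 2 :=
  Summable.of_nonneg_of_le (fun _ => mul_nonneg (weight_pos _).le (sq_nonneg _))
    (fun _ => mul_le_mul_of_nonneg_right (weight_add_single_le _ k) (sq_nonneg _)) f.2

lemma X_mul_mem {d : ℕ} (k : Fin d) (f : H2 d) : MvPowerSeries.X k * f.1 ∈ H2 d := by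
  rw [mem_H2, ← (add_single_injective k).summable_iff fun n hn => by
    simp [coeff_X_mul_of_notMem_range k f.1 n hn]]
  refine (summable_shift k f).congr fun m => ?_
  simp only [Function.comp_apply, coeff_add_single_X_mul]

/-- The component `S_k : f(z) ↦ z_k f(z)` of the rank-one `d`-shift, a bounded operator on
`H²(ℂ^d)`. -/
def shift₁ {d : ℕ} (k : Fin d) : H2 d →L[ℂ] H2 d :=
  LinearMap.mkContinuous
    { toFun := fun f => ⟨MvPowerSeries.X k * f.1, X_mul_mem k f⟩
      map_add' := fun f g => Subtype.ext (mul_add _ _ _)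
      map_smul' := fun c f => Subtype.ext (mul_smul_comm _ _ _) } 1 (fun f => by
    rw [one_mul, ← sq_le_sq₀ (norm_nonneg _) (norm_nonneg _), norm_sq_eq, norm_sq_eq]
    change ∑' n, weight n * ‖MvPowerSeries.coeff n (MvPowerSeries.X k * f.1)‖ ^ 2 ≤ _
    rw [← (add_single_injective k).tsum_eq (support_X_mul k f.1)]
    simp only [coeff_add_single_X_mul]
    exact (summable_shift k f).tsum_le_tsum
      (fun m => mul_le_mul_of_nonneg_right (weight_add_single_le m k) (sq_nonneg _)) f.2)

lemma coe_shift₁ {d : ℕ} (k : Fin d) (f : H2 d) :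
    ((shift₁ k f : H2 d) : MvPowerSeries (Fin d) ℂ) = MvPowerSeries.X k * f.1 := rfl

lemma monomial_mem {d : ℕ} (n : Fin d →₀ ℕ) : MvPowerSeries.monomial n (1 : ℂ) ∈ H2 d := by
  classical
  rw [mem_H2]
  refine summable_of_ne_finset_zero (s := {n}) fun m hm => ?_
  rw [MvPowerSeries.coeff_monomial_ne (by simpa using hm)]
  simp

/-- The monomial `z ^ n = z₁ ^ n₁ ⋯ z_d ^ n_d`, as an element of `H²(ℂ^d)`. -/
def zMonomial {d : ℕ} (n : Fin d →₀ ℕ) : H2 d := ⟨MvPowerSeries.monomial n 1, monomial_mem n⟩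

/-- The Hilbert space `H² ⊗ ℂ^r`. As `ℂ^r` is finite-dimensional, the algebraic tensor product,
with its canonical inner product `⟪f ⊗ ζ, g ⊗ η⟫ = ⟪f, g⟫ ⟪ζ, η⟫`, is already complete. -/
abbrev H2Tensor (d r : ℕ) : Type := H2 d ⊗[ℂ] EuclideanSpace ℂ (Fin r)

/-- The isometry `(f₁, …, f_r) ↦ ∑ fᵢ ⊗ eᵢ` from the direct sum of `r` copies of `H²` to
`H² ⊗ ℂ^r`. -/
def directSumToTensor (d r : ℕ) : PiLp 2 (fun _ : Fin r => H2 d) →ₗᵢ[ℂ] H2Tensor d r where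
  toFun f := ∑ i, f i ⊗ₜ[ℂ] EuclideanSpace.single i (1 : ℂ)
  map_add' f g := by simp [TensorProduct.add_tmul, Finset.sum_add_distrib]
  map_smul' c f := by simp [TensorProduct.smul_tmul', Finset.smul_sum]
  norm_map' f := by
    rw [← sq_eq_sq₀ (norm_nonneg _) (norm_nonneg _), PiLp.norm_sq_eq_of_L2]
    have h : ⟪∑ i, f i ⊗ₜ[ℂ] EuclideanSpace.single i (1 : ℂ),
        ∑ i, f i ⊗ₜ[ℂ] EuclideanSpace.single i (1 : ℂ)⟫_ℂ
        = ((∑ i, ‖f i‖ ^ 2 : ℝ) : ℂ) := by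
      simp only [sum_inner, inner_sum, TensorProduct.inner_tmul,
        EuclideanSpace.inner_single_left, PiLp.single_apply, map_one, mul_ite, mul_one,
        mul_zero, Finset.sum_ite_eq', Finset.mem_univ, if_true,
        inner_self_eq_norm_sq_to_K]
      push_cast
      rfl
    have h' := (inner_self_eq_norm_sq_to_K (𝕜 := ℂ)
      (∑ i, f i ⊗ₜ[ℂ] EuclideanSpace.single i (1 : ℂ))).symm.trans h
    exact Complex.ofReal_injective ((Complex.ofReal_pow _ 2).trans h')

lemma directSumToTensor_surjective (d r : ℕ) : Function.Surjective (directSumToTensor d r) := by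
  intro x
  induction x using TensorProduct.induction_on with
  | zero => exact ⟨0, map_zero _⟩
  | add x y hx hy =>
    obtain ⟨a, rfl⟩ := hx
    obtain ⟨b, rfl⟩ := hy
    exact ⟨a + b, map_add _ _ _⟩
  | tmul f ζ =>
    refine ⟨WithLp.toLp 2 fun i => ζ i • f, ?_⟩
    change ∑ i, (ζ i • f) ⊗ₜ[ℂ] EuclideanSpace.single i (1 : ℂ) = _
    simp_rw [TensorProduct.smul_tmul, ← TensorProduct.tmul_sum]
    congr 1
    ext j
    simp [Pi.single_apply]

instance instCompleteSpaceTensor (d r : ℕ) : CompleteSpace (H2Tensor d r) :=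
  ((LinearIsometryEquiv.ofSurjective _
    (directSumToTensor_surjective d r)).toIsometryEquiv.completeSpace_iff).1 inferInstance

/-- The component `S_k ⊗ 1 : f ⊗ ζ ↦ z_k f ⊗ ζ` of the `d`-shift of rank `r`. -/
def shift {d : ℕ} (r : ℕ) (k : Fin d) : H2Tensor d r →L[ℂ] H2Tensor d r :=
  (shift₁ k).rTensor (EuclideanSpace ℂ (Fin r))

/-- The monomials of `H² ⊗ ℂ^r` are the elements `z ^ n ⊗ ζ`. -/
def IsMonomial {d r : ℕ} (x : H2Tensor d r) : Prop :=
  ∃ (n : Fin d →₀ ℕ) (ζ : EuclideanSpace ℂ (Fin r)), x = zMonomial n ⊗ₜ[ℂ] ζ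

/-- A closed subspace that is invariant under every component of the `d`-shift. -/
def IsInvariant {d r : ℕ} (M : ClosedSubmodule ℂ (H2Tensor d r)) : Prop :=
  ∀ k : Fin d, ∀ x ∈ M, shift r k x ∈ M

/-- `M` is generated by `G` as a (closed) invariant subspace: it is the smallest closed invariant
subspace that contains `G`. -/
def IsGeneratedBy {d r : ℕ} (M : ClosedSubmodule ℂ (H2Tensor d r)) (G : Set (H2Tensor d r)) :
    Prop :=
  IsLeast {N : ClosedSubmodule ℂ (H2Tensor d r) | IsInvariant N ∧ G ⊆ N} M

/-- For `s > 0`, the multiplicity of `s` in the list of singular values of `T`: that of `s ^ 2` as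
an eigenvalue of `T* T`, equivalently that of `s` as an eigenvalue of `|T| = (T* T) ^ (1/2)`. -/
def singularMultiplicity {H : Type*} [NormedAddCommGroup H] [InnerProductSpace ℂ H]
    [CompleteSpace H] (T : H →L[ℂ] H) (s : ℝ) : ℕ :=
  Module.finrank ℂ (Module.End.eigenspace
    ((ContinuousLinearMap.adjoint T ∘L T : H →L[ℂ] H) : H →ₗ[ℂ] H) ((s ^ 2 : ℝ) : ℂ))

/-- The Schatten-von Neumann class `𝓛^p` (`0 < p < ∞`): the compact operators whose list of
(nonzero) singular values, repeated according to multiplicity, is `p`-summable. -/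
def MemSchatten {H : Type*} [NormedAddCommGroup H] [InnerProductSpace ℂ H]
    [CompleteSpace H] (p : ℝ) (T : H →L[ℂ] H) : Prop :=
  IsCompactOperator T ∧
    Summable fun s : Set.Ioi (0 : ℝ) => (singularMultiplicity T s : ℝ) * (s : ℝ) ^ p

end

end DruryArveson

/-!
A subspace `M` generated by monomials is the closed direct sum of the blocks `z ^ n ⊗ E n`, where
`E n = fiber M n ⊆ ℂ^r` increases with the multi-index `n`. Consequently `P_M` is block diagonal
(`starProjection_zMonomial_tmul`), and `T = P_M S_k - S_k P_M` carries `z ^ n ⊗ ζ` to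
`z ^ (n + e_k) ⊗ Q n ζ`, with `Q n` the orthogonal projection onto the part of `E (n + e_k)`
orthogonal to `E n` (`isBlockShift_commutator`).

Thus `T* T` acts on the block `n` as `(n_k + 1) / (|n| + 1)` times the projection `Q n`, and the
nonzero singular values of `T` are the numbers `((n_k + 1) / (|n| + 1)) ^ (1 / 2)`, repeated
`rank (Q n) ≤ r` times for each `n` (`IsBlockShift.memSchatten`). By Dickson's lemma and the
ascending chain condition in `ℂ^r`, there is an `N` with `Q n = 0` whenever `n_k ≥ N`
(`exists_bound_of_ne_add_single`). Hence the sum of the `p`-th powers of the singular values is at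
most `r N ^ (p / 2) ∑ (|n| + 1) ^ (-p / 2)`, a series over `ℕ^d` that converges for `p / 2 > d`
(`summable_degree_add_one_rpow`).
-/

namespace DruryArveson

open scoped TensorProduct InnerProductSpace ComplexConjugate

/-! ### Weighted shifts of projections between the blocks of a Hilbert sum -/

section BlockOperator

variable {ι H V : Type*} [NormedAddCommGroup H] [InnerProductSpace ℂ H] [CompleteSpace H]
  [NormedAddCommGroup V] [InnerProductSpace ℂ V] [FiniteDimensional ℂ V]

/-- `T` carries the block `J n` of a Hilbert sum into the block `J (σ n)`, as `a n` times the
orthogonal projection `Q n`. Different blocks have orthogonal images since `σ` is injective. -/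
structure IsBlockShift (J : ι → V →ₗᵢ[ℂ] H) (σ : ι → ι) (a : ι → ℝ) (Q : ι → V →L[ℂ] V)
    (T : H →L[ℂ] H) : Prop where
  isHilbertSum : IsHilbertSum ℂ (fun _ : ι => V) J
  injective : Function.Injective σ
  isStarProjection : ∀ n, IsStarProjection (Q n)
  nonneg : ∀ n, 0 ≤ a n
  apply_block : ∀ n v, T (J n v) = (a n : ℂ) • J (σ n) (Q n v)

lemma _root_.IsStarProjection.inner_apply_apply {Q : V →L[ℂ] V} (hQ : IsStarProjection Q)
    (u v : V) : ⟪Q u, Q v⟫_ℂ = ⟪u, Q v⟫_ℂ := by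
  have h1 := hQ.isSelfAdjoint.adjoint_eq
  have h2 : Q (Q v) = Q v := congrArg (fun A : V →L[ℂ] V => A v) hQ.isIdempotentElem
  rw [← ContinuousLinearMap.adjoint_inner_right, h1, h2]

lemma _root_.IsStarProjection.norm_apply_le_self {Q : V →L[ℂ] V} (hQ : IsStarProjection Q)
    (v : V) : ‖Q v‖ ≤ ‖v‖ := by
  have h : ‖Q v‖ ^ 2 ≤ ‖v‖ * ‖Q v‖ := by
    rw [← inner_self_eq_norm_sq (𝕜 := ℂ), hQ.inner_apply_apply]
    exact (RCLike.re_le_norm _).trans (norm_inner_le_norm _ _)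
  by_contra! hlt
  nlinarith [norm_nonneg v]

omit [FiniteDimensional ℂ V] in
lemma _root_.IsHilbertSum.eq_zero_of_inner_eq_zero {J : ι → V →ₗᵢ[ℂ] H}
    (hJ : IsHilbertSum ℂ (fun _ : ι => V) J) {x : H} (hx : ∀ n v, ⟪J n v, x⟫_ℂ = 0) : x = 0 := by
  have h := hJ.hasSum_linearIsometryEquiv_symm (hJ.linearIsometryEquiv x)
  rw [LinearIsometryEquiv.symm_apply_apply] at h
  have h2 := h.mapL (innerSL ℂ x)
  have h3 : (fun n => innerSL ℂ x (J n (hJ.linearIsometryEquiv x n))) = fun _ => 0 := by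
    funext n
    rw [innerSL_apply_apply, ← inner_conj_symm, hx, map_zero]
  rw [h3] at h2
  exact inner_self_eq_zero.1 (h2.unique hasSum_zero)

namespace IsBlockShift

variable {J : ι → V →ₗᵢ[ℂ] H} {σ : ι → ι} {a : ι → ℝ} {Q : ι → V →L[ℂ] V} {T : H →L[ℂ] H}

lemma inner_apply_of_ne (h : IsBlockShift J σ a Q T) {m n : ι} (hmn : m ≠ n) (u v : V) :
    ⟪T (J m u), T (J n v)⟫_ℂ = 0 := by
  rw [h.apply_block, h.apply_block, inner_smul_left, inner_smul_right,
    h.isHilbertSum.OrthogonalFamily (h.injective.ne hmn), mul_zero, mul_zero]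

/-- `T* T` acts on the block `n` as `a n ^ 2` times the projection `Q n`. -/
lemma adjoint_comp_apply_block (h : IsBlockShift J σ a Q T) (n : ι) (v : V) :
    (ContinuousLinearMap.adjoint T) (T (J n v)) = ((a n ^ 2 : ℝ) : ℂ) • J n (Q n v) := by
  rw [← sub_eq_zero]
  refine h.isHilbertSum.eq_zero_of_inner_eq_zero fun m u => ?_
  rw [inner_sub_right, ContinuousLinearMap.adjoint_inner_right, inner_smul_right]
  rcases eq_or_ne m n with rfl | hmn
  · rw [h.apply_block, h.apply_block, inner_smul_left, inner_smul_right,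
      LinearIsometry.inner_map_map, LinearIsometry.inner_map_map,
      (h.isStarProjection m).inner_apply_apply, Complex.conj_ofReal]
    push_cast
    ring
  · rw [h.inner_apply_of_ne hmn, h.isHilbertSum.OrthogonalFamily hmn, mul_zero, sub_zero]

/-- An eigenvector of `T* T` for `s ^ 2` lives in the blocks `n` with `a n = s`. -/
lemma inner_eq_zero_of_mem_eigenspace (h : IsBlockShift J σ a Q T) {s : ℝ} (hs : 0 < s) {x : H}
    (hx : (ContinuousLinearMap.adjoint T) (T x) = ((s ^ 2 : ℝ) : ℂ) • x) {n : ι} (hn : a n ≠ s)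
    (v : V) : ⟪J n v, x⟫_ℂ = 0 := by
  have key : ∀ v, ((s ^ 2 : ℝ) : ℂ) * ⟪J n v, x⟫_ℂ
      = ((a n ^ 2 : ℝ) : ℂ) * ⟪J n (Q n v), x⟫_ℂ := by
    intro v
    have h1 : ⟪J n v, ContinuousLinearMap.adjoint T (T x)⟫_ℂ
        = ⟪ContinuousLinearMap.adjoint T (T (J n v)), x⟫_ℂ := by
      rw [ContinuousLinearMap.adjoint_inner_right, ContinuousLinearMap.adjoint_inner_left]
    rwa [hx, h.adjoint_comp_apply_block, inner_smul_right, inner_smul_left,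
      Complex.conj_ofReal] at h1
  have hQQ : Q n (Q n v) = Q n v :=
    congrArg (fun A : V →L[ℂ] V => A v) (h.isStarProjection n).isIdempotentElem
  have hne : ((s ^ 2 : ℝ) : ℂ) - ((a n ^ 2 : ℝ) : ℂ) ≠ 0 := by
    rw [sub_ne_zero]
    intro he
    have he' := Complex.ofReal_injective he
    exact hn ((pow_left_inj₀ (h.nonneg n) hs.le two_ne_zero).1 he'.symm)
  -- Applied to `Q n v`, the identity `key` says `s ^ 2 = a n ^ 2` or `⟪J n (Q n v), x⟫ = 0`.
  have hQ : ⟪J n (Q n v), x⟫_ℂ = 0 := by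
    have h2 := key (Q n v)
    rw [hQQ] at h2
    exact (mul_eq_zero.1 ((sub_mul _ _ _).trans (sub_eq_zero.2 h2))).resolve_left hne
  have h3 := key v
  rw [hQ, mul_zero] at h3
  refine (mul_eq_zero.1 h3).resolve_left ?_
  exact_mod_cast (pow_pos hs 2).ne'

lemma singularMultiplicity_le (h : IsBlockShift J σ a Q T) {s : ℝ} (hs : 0 < s)
    (hfin : Finite {n // a n = s}) :
    singularMultiplicity T s ≤ Nat.card {n // a n = s} * Module.finrank ℂ V := by
  have := Fintype.ofFinite {n // a n = s}
  let L : H →ₗ[ℂ] ({n // a n = s} → V) := LinearMap.pi fun n =>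
    (ContinuousLinearMap.adjoint (J n).toContinuousLinearMap : H →L[ℂ] V).toLinearMap
  have hL : Function.Injective (L.domRestrict (Module.End.eigenspace
    ((ContinuousLinearMap.adjoint T ∘L T : H →L[ℂ] H) : H →ₗ[ℂ] H) ((s ^ 2 : ℝ) : ℂ))) := by
    rw [injective_iff_map_eq_zero]
    rintro ⟨x, hx⟩ hLx
    rw [Module.End.mem_eigenspace_iff] at hx
    refine Subtype.ext (h.isHilbertSum.eq_zero_of_inner_eq_zero fun n v => ?_)
    by_cases hn : a n = s
    · have h1 : ContinuousLinearMap.adjoint (J n).toContinuousLinearMap x = 0 :=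
        congrFun hLx ⟨n, hn⟩
      have h2 := ContinuousLinearMap.adjoint_inner_right (J n).toContinuousLinearMap v x
      rw [h1, inner_zero_right] at h2
      exact h2.symm
    · exact h.inner_eq_zero_of_mem_eigenspace hs hx hn v
  have h3 := LinearMap.finrank_le_finrank_of_injective hL
  rwa [Module.finrank_pi_fintype, Finset.sum_const, Finset.card_univ, smul_eq_mul,
    ← Nat.card_eq_fintype_card] at h3

lemma norm_le (h : IsBlockShift J σ a Q T) {ε : ℝ} (hε : 0 ≤ ε) (ha : ∀ n, a n ≤ ε) :
    ‖T‖ ≤ ε := by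
  classical
  refine T.opNorm_le_bound hε fun x => ?_
  set w := h.isHilbertSum.linearIsometryEquiv x
  have hx : HasSum (fun n => J n (w n)) x := by
    have := h.isHilbertSum.hasSum_linearIsometryEquiv_symm w
    rwa [LinearIsometryEquiv.symm_apply_apply] at this
  refine le_of_tendsto_of_tendsto (((T.continuous.tendsto x).comp hx).norm)
    ((hx.norm).const_mul ε) (Filter.Eventually.of_forall fun F => ?_)
  -- Both sides are norms of sums of orthogonal vectors.
  have h1 : ‖T (∑ n ∈ F, J n (w n))‖ ^ 2 = ∑ n ∈ F, a n ^ 2 * ‖Q n (w n)‖ ^ 2 := by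
    have e : T (∑ n ∈ F, J n (w n)) = ∑ n ∈ F, J (σ n) ((a n : ℂ) • Q n (w n)) := by
      simp only [map_sum, h.apply_block, map_smul]
    rw [e, (h.isHilbertSum.OrthogonalFamily.comp h.injective).norm_sum]
    refine Finset.sum_congr rfl fun n _ => ?_
    rw [norm_smul, Complex.norm_real, mul_pow, Real.norm_eq_abs, sq_abs]
  have h2 := h.isHilbertSum.OrthogonalFamily.norm_sum (fun n => w n) F
  refine (sq_le_sq₀ (norm_nonneg _) (mul_nonneg hε (norm_nonneg _))).1 ?_
  change ‖T (∑ n ∈ F, J n (w n))‖ ^ 2 ≤ (ε * ‖∑ n ∈ F, J n (w n)‖) ^ 2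
  rw [h1, mul_pow, h2, Finset.mul_sum]
  refine Finset.sum_le_sum fun n _ => mul_le_mul (pow_le_pow_left₀ (h.nonneg n) (ha n) 2)
    (pow_le_pow_left₀ (norm_nonneg _) ((h.isStarProjection n).norm_apply_le_self _) 2)
    (sq_nonneg _) (sq_nonneg _)

lemma isCompactOperator (h : IsBlockShift J σ a Q T)
    (ha : Filter.Tendsto a Filter.cofinite (nhds 0)) : IsCompactOperator T := by
  classical
  -- The operators `T` cut down to finitely many blocks have finite rank and converge to `T`.
  let P : ι → H →L[ℂ] H := fun n =>
    (T ∘L (J n).toContinuousLinearMap) ∘L ContinuousLinearMap.adjoint (J n).toContinuousLinearMap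
  have hP : ∀ m n v, P m (J n v) = if m = n then T (J n v) else 0 := by
    intro m n v
    change T (J m (ContinuousLinearMap.adjoint (J m).toContinuousLinearMap (J n v))) = _
    split_ifs with hmn
    · subst hmn
      congr 2
      refine ext_inner_left ℂ fun u => ?_
      rw [ContinuousLinearMap.adjoint_inner_right]
      exact (J m).inner_map_map u v
    · have : ContinuousLinearMap.adjoint (J m).toContinuousLinearMap (J n v) = 0 := by
        refine ext_inner_left ℂ fun u => ?_
        rw [ContinuousLinearMap.adjoint_inner_right, inner_zero_right]
        exact h.isHilbertSum.OrthogonalFamily hmn u v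
      rw [this, map_zero, map_zero]
  have hcpt : ∀ F : Finset ι, IsCompactOperator (∑ n ∈ F, P n : H →L[ℂ] H) := by
    intro F
    refine Submodule.sum_mem (compactOperator (RingHom.id ℂ) H H) fun n _ => ?_
    have := ((isCompactOperator_id (E := V)).comp_clm
      (ContinuousLinearMap.adjoint (J n).toContinuousLinearMap)).clm_comp
      (T ∘L (J n).toContinuousLinearMap)
    exact this
  refine isCompactOperator_of_tendsto (F := fun F : Finset ι => ∑ n ∈ F, P n)
    (l := Filter.atTop) ?_ (Filter.Eventually.of_forall hcpt)
  rw [Metric.tendsto_atTop]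
  intro ε hε
  have hfin : {n | ¬ a n < ε / 2}.Finite := ha.eventually (gt_mem_nhds (half_pos hε))
  refine ⟨hfin.toFinset, fun F hF => ?_⟩
  rw [dist_comm, dist_eq_norm]
  have hB : IsBlockShift J σ (fun n => if n ∈ F then 0 else a n) Q (T - ∑ n ∈ F, P n) := by
    refine ⟨h.isHilbertSum, h.injective, h.isStarProjection, fun n => ?_, fun n v => ?_⟩
    · split_ifs
      exacts [le_rfl, h.nonneg n]
    · rw [sub_apply, sum_apply]
      simp only [hP, Finset.sum_ite_eq']
      split_ifs
      · simp
      · rw [sub_zero, h.apply_block]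
  refine (hB.norm_le (half_pos hε).le fun n => ?_).trans_lt (half_lt_self hε)
  split_ifs with hn
  · exact (half_pos hε).le
  · by_contra hc
    exact hn (hF (hfin.mem_toFinset.2 fun hlt => hc hlt.le))

/-- The list of singular values of `T` is dominated by `finrank V` copies of the family `a`. -/
theorem memSchatten (h : IsBlockShift J σ a Q T) {p : ℝ} (hp : 0 < p)
    (ha : Summable fun n => a n ^ p) : MemSchatten p T := by
  have h0 : Filter.Tendsto a Filter.cofinite (nhds 0) := by
    have h1 := ha.tendsto_cofinite_zero.rpow_const (p := p⁻¹) (Or.inr (inv_nonneg.2 hp.le))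
    rw [Real.zero_rpow (inv_ne_zero hp.ne')] at h1
    refine h1.congr fun n => Real.rpow_rpow_inv (h.nonneg n) hp.ne'
  refine ⟨h.isCompactOperator h0, ?_⟩
  have hfin : ∀ s : ℝ, 0 < s → Finite {n // a n = s} := by
    intro s hs
    have hf : {n | ¬ a n < s}.Finite := h0.eventually (gt_mem_nhds hs)
    exact hf.subset fun n (hn : a n = s) => by simp [hn]
  -- Grouping the terms `a n ^ p` by the value of `a n`.
  have hsum : Summable fun s : ℝ => ∑' n : {n // a n = s}, a n ^ p :=
    ((Equiv.sigmaFiberEquiv a).summable_iff.2 ha).sigma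
  refine Summable.of_nonneg_of_le (fun s => ?_) (fun s => ?_)
    ((hsum.comp_injective Subtype.val_injective).mul_left (Module.finrank ℂ V : ℝ))
  · exact mul_nonneg (Nat.cast_nonneg _) (Real.rpow_nonneg (Set.mem_Ioi.1 s.2).le p)
  · have hs : (0 : ℝ) < s := s.2
    have hle : (singularMultiplicity T s : ℝ)
        ≤ Nat.card {n // a n = (s : ℝ)} * Module.finrank ℂ V := by
      exact_mod_cast h.singularMultiplicity_le hs (hfin s hs)
    have ht : ∑' n : {n // a n = (s : ℝ)}, a n ^ p
        = Nat.card {n // a n = (s : ℝ)} * (s : ℝ) ^ p := by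
      rw [tsum_congr fun n : {n // a n = (s : ℝ)} => by rw [n.2], tsum_const, nsmul_eq_mul]
    rw [Function.comp_apply, ht]
    calc (singularMultiplicity T s : ℝ) * (s : ℝ) ^ p
        ≤ Nat.card {n // a n = (s : ℝ)} * Module.finrank ℂ V * (s : ℝ) ^ p :=
          mul_le_mul_of_nonneg_right hle (Real.rpow_nonneg hs.le p)
      _ = _ := by ring

end IsBlockShift

end BlockOperator

/-! ### Summability over multi-indices -/

lemma summable_prod_apply {f : ℕ → ℝ} (hf : Summable f) (hf0 : ∀ m, 0 ≤ f m) (d : ℕ) :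
    Summable fun n : Fin d → ℕ => ∏ i, f (n i) := by
  induction d with
  | zero => exact (hasSum_fintype _).summable
  | succ d ih =>
    have h := hf.mul_of_nonneg ih hf0 fun n => Finset.prod_nonneg fun i _ => hf0 (n i)
    rw [← (Fin.consEquiv fun _ : Fin (d + 1) => ℕ).summable_iff]
    refine h.congr fun x => ?_
    simp [Fin.prod_univ_succ, Fin.consEquiv]

/-- Since `n i + 1 ≤ |n| + 1` for each of the `d` indices `i`, the term `(|n| + 1) ^ (-q)` is at
most the product of the `(n i + 1) ^ (-q / d)`, and `q / d > 1`. -/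
lemma summable_degree_add_one_rpow {d : ℕ} {q : ℝ} (hq : (d : ℝ) < q) :
    Summable fun n : Fin d →₀ ℕ => ((n.degree : ℝ) + 1) ^ (-q) := by
  rcases Nat.eq_zero_or_pos d with rfl | hd
  · exact (hasSum_fintype _).summable
  have hd' : (0 : ℝ) < d := by exact_mod_cast hd
  have h1 : Summable fun m : ℕ => ((m : ℝ) + 1) ^ (-(q / d)) := by
    have := (summable_nat_add_iff 1).2
      (Real.summable_nat_rpow.2 (neg_lt_neg ((one_lt_div hd').2 hq)))
    simpa using this
  have h2 := summable_prod_apply h1 (fun m => by positivity) d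
  refine Summable.of_nonneg_of_le (fun n => by positivity) (fun n => ?_)
    (Finsupp.equivFunOnFinite.summable_iff.2 h2)
  have h3 : ∏ _i : Fin d, ((n.degree : ℝ) + 1) ^ (-(q / d)) = ((n.degree : ℝ) + 1) ^ (-q) := by
    rw [Finset.prod_const, Finset.card_univ, Fintype.card_fin, ← Real.rpow_natCast,
      ← Real.rpow_mul (by positivity)]
    congr 1
    field_simp
  rw [← h3]
  refine Finset.prod_le_prod (fun i _ => by positivity) fun i _ => ?_
  refine Real.rpow_le_rpow_of_nonpos (by positivity) ?_ ?_
  · have : (n i : ℝ) ≤ n.degree := by exact_mod_cast Finsupp.le_degree i n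
    simpa using this
  · exact neg_nonpos.2 (div_nonneg (hd'.trans hq).le hd'.le)

/-! ### Increasing families over multi-indices -/

/-- A monotone family over `ℕ^d` with values in a partial order with the ascending chain condition
can jump in direction `k` only at indices with bounded `k`-th entry: otherwise, by Dickson's
lemma, infinitely many jumps would be stacked on top of one another. -/
lemma exists_bound_of_ne_add_single {d : ℕ} {α : Type*} [PartialOrder α] [WellFoundedGT α]
    {E : (Fin d →₀ ℕ) → α} (hE : Monotone E) (k : Fin d) :
    ∃ N : ℕ, ∀ n, E (n + Finsupp.single k 1) ≠ E n → n k < N := by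
  by_contra! hcon
  choose u hne hle using hcon
  obtain ⟨g, hg⟩ := (wellQuasiOrdered_le (α := Fin d →₀ ℕ)).exists_monotone_subseq u
  obtain ⟨m, hm⟩ := WellFoundedGT.monotone_chain_condition (⟨fun j => E (u (g j)),
    fun i j hij => hE (hg i j hij)⟩ : ℕ →o α)
  -- A later index `j` whose `k`-th entry is strictly larger than that of the index `m`.
  obtain ⟨j, hmj, hj⟩ : ∃ j, m ≤ j ∧ u (g m) k + 1 ≤ u (g j) k := by
    refine ⟨max m (u (g m) k + 1), le_max_left _ _, ?_⟩
    exact (le_max_right m _).trans ((g.strictMono.id_le _).trans (hle _))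
  have hstep : u (g m) + Finsupp.single k 1 ≤ u (g j) := by
    intro i
    have := hg m j hmj i
    rcases eq_or_ne i k with rfl | hik
    · simpa using hj
    · simpa [Finsupp.single_apply, hik.symm] using this
  refine hne (g m) (le_antisymm ?_ (hE le_self_add))
  exact (hE hstep).trans (hm j hmj).ge

/-! ### Monomials in `H² ⊗ ℂ^r` -/

lemma inner_zMonomial {d : ℕ} (n : Fin d →₀ ℕ) (f : H2 d) :
    ⟪zMonomial n, f⟫_ℂ = (weight n : ℂ) * MvPowerSeries.coeff n f.1 := by
  classical
  rw [inner_def, tsum_eq_single n fun m hm => ?_]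
  · change (weight n : ℂ) *
      (conj (MvPowerSeries.coeff n (MvPowerSeries.monomial n (1 : ℂ))) * _) = _
    rw [MvPowerSeries.coeff_monomial_same, map_one, one_mul]
  · change (weight m : ℂ) *
      (conj (MvPowerSeries.coeff m (MvPowerSeries.monomial n (1 : ℂ))) * _) = _
    rw [MvPowerSeries.coeff_monomial_ne hm, map_zero, zero_mul, mul_zero]

lemma inner_zMonomial_zMonomial {d : ℕ} [DecidableEq (Fin d →₀ ℕ)] (m n : Fin d →₀ ℕ) :
    ⟪zMonomial m, zMonomial n⟫_ℂ = if m = n then (weight n : ℂ) else 0 := by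
  rw [inner_zMonomial]
  change (weight m : ℂ) * MvPowerSeries.coeff m (MvPowerSeries.monomial n (1 : ℂ)) = _
  split_ifs with h
  · rw [h, MvPowerSeries.coeff_monomial_same, mul_one]
  · rw [MvPowerSeries.coeff_monomial_ne h, mul_zero]

lemma shift₁_zMonomial {d : ℕ} (k : Fin d) (n : Fin d →₀ ℕ) :
    shift₁ k (zMonomial n) = zMonomial (n + Finsupp.single k 1) := by
  refine Subtype.ext ?_
  rw [coe_shift₁]
  change MvPowerSeries.monomial (Finsupp.single k 1) 1 * MvPowerSeries.monomial n (1 : ℂ)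
    = MvPowerSeries.monomial (n + Finsupp.single k 1) 1
  rw [MvPowerSeries.monomial_mul_monomial, mul_one, add_comm]

lemma shift_zMonomial_tmul {d r : ℕ} (k : Fin d) (n : Fin d →₀ ℕ)
    (ζ : EuclideanSpace ℂ (Fin r)) :
    shift r k (zMonomial n ⊗ₜ[ℂ] ζ) = zMonomial (n + Finsupp.single k 1) ⊗ₜ[ℂ] ζ := by
  rw [← shift₁_zMonomial]
  rfl

lemma inner_zMonomial_tmul_shift_eq_zero {d r : ℕ} (k : Fin d) {n : Fin d →₀ ℕ} (hn : n k = 0)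
    (ζ : EuclideanSpace ℂ (Fin r)) (x : H2Tensor d r) :
    ⟪zMonomial n ⊗ₜ[ℂ] ζ, shift r k x⟫_ℂ = 0 := by
  induction x using TensorProduct.induction_on with
  | zero => simp
  | add x y hx hy => rw [map_add, inner_add_right, hx, hy, add_zero]
  | tmul f η =>
    change ⟪zMonomial n ⊗ₜ[ℂ] ζ, shift₁ k f ⊗ₜ[ℂ] η⟫_ℂ = 0
    rw [TensorProduct.inner_tmul, inner_zMonomial, coe_shift₁, coeff_X_mul_of_notMem_range,
      mul_zero, zero_mul]
    rintro ⟨m, rfl⟩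
    simp at hn

lemma inner_zMonomial_add_single_tmul_shift {d r : ℕ} (k : Fin d) (n : Fin d →₀ ℕ)
    (ζ : EuclideanSpace ℂ (Fin r)) (x : H2Tensor d r) :
    (weight n : ℂ) * ⟪zMonomial (n + Finsupp.single k 1) ⊗ₜ[ℂ] ζ, shift r k x⟫_ℂ
      = (weight (n + Finsupp.single k 1) : ℂ) * ⟪zMonomial n ⊗ₜ[ℂ] ζ, x⟫_ℂ := by
  induction x using TensorProduct.induction_on with
  | zero => simp
  | add x y hx hy => rw [map_add, inner_add_right, inner_add_right, mul_add, hx, hy, mul_add]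
  | tmul f η =>
    change (weight n : ℂ) * ⟪zMonomial (n + Finsupp.single k 1) ⊗ₜ[ℂ] ζ, shift₁ k f ⊗ₜ[ℂ] η⟫_ℂ = _
    rw [TensorProduct.inner_tmul, TensorProduct.inner_tmul, inner_zMonomial, inner_zMonomial,
      coe_shift₁, coeff_add_single_X_mul]
    ring

lemma eq_zero_of_inner_zMonomial_tmul {d r : ℕ} {x : H2Tensor d r}
    (hx : ∀ n ζ, ⟪zMonomial n ⊗ₜ[ℂ] ζ, x⟫_ℂ = 0) : x = 0 := by
  obtain ⟨f, rfl⟩ := directSumToTensor_surjective d r x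
  suffices hf : f = 0 by rw [hf, map_zero]
  ext i : 1
  refine Subtype.ext (MvPowerSeries.ext fun n => ?_)
  have h := hx n (EuclideanSpace.single i 1)
  change ⟪_, ∑ j, f j ⊗ₜ[ℂ] EuclideanSpace.single j (1 : ℂ)⟫_ℂ = 0 at h
  simp only [inner_sum, TensorProduct.inner_tmul, EuclideanSpace.inner_single_left,
    PiLp.single_apply, map_one, mul_ite, mul_one, mul_zero, Finset.sum_ite_eq,
    Finset.mem_univ, if_true, inner_zMonomial] at h
  exact (mul_eq_zero.1 h).resolve_left (by exact_mod_cast (weight_pos n).ne')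

/-- The isometric embedding `ζ ↦ (z ^ n / ‖z ^ n‖) ⊗ ζ` of `ℂ^r` into `H² ⊗ ℂ^r`. -/
noncomputable def monomialEmbedding {d : ℕ} (r : ℕ) (n : Fin d →₀ ℕ) :
    EuclideanSpace ℂ (Fin r) →ₗᵢ[ℂ] H2Tensor d r where
  toLinearMap := ((√(weight n) : ℂ)⁻¹) •
    TensorProduct.mk ℂ (H2 d) (EuclideanSpace ℂ (Fin r)) (zMonomial n)
  norm_map' ζ := by
    classical
    have hz : ‖zMonomial n‖ = √(weight n) := by
      have h := inner_zMonomial_zMonomial n n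
      rw [if_pos rfl, inner_self_eq_norm_sq_to_K] at h
      have h' : ‖zMonomial n‖ ^ 2 = weight n :=
        Complex.ofReal_injective ((Complex.ofReal_pow _ 2).trans h)
      rw [← h', Real.sqrt_sq (norm_nonneg _)]
    have hw : √(weight n) ≠ 0 := (Real.sqrt_pos.2 (weight_pos n)).ne'
    change ‖(√(weight n) : ℂ)⁻¹ • (zMonomial n ⊗ₜ[ℂ] ζ)‖ = ‖ζ‖
    rw [norm_smul, TensorProduct.norm_tmul, hz, norm_inv, Complex.norm_real, Real.norm_eq_abs,
      abs_of_nonneg (Real.sqrt_nonneg _), inv_mul_cancel_left₀ hw]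

lemma monomialEmbedding_apply {d r : ℕ} (n : Fin d →₀ ℕ) (ζ : EuclideanSpace ℂ (Fin r)) :
    monomialEmbedding r n ζ = (√(weight n) : ℂ)⁻¹ • (zMonomial n ⊗ₜ[ℂ] ζ) := rfl

lemma inner_zMonomial_tmul_of_ne {d r : ℕ} {m n : Fin d →₀ ℕ} (hmn : m ≠ n)
    (ζ η : EuclideanSpace ℂ (Fin r)) :
    ⟪zMonomial m ⊗ₜ[ℂ] ζ, zMonomial n ⊗ₜ[ℂ] η⟫_ℂ = 0 := by
  classical
  rw [TensorProduct.inner_tmul, inner_zMonomial_zMonomial, if_neg hmn, zero_mul]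

lemma isHilbertSum_monomialEmbedding (d r : ℕ) :
    IsHilbertSum ℂ (fun _ : Fin d →₀ ℕ => EuclideanSpace ℂ (Fin r)) (monomialEmbedding r) := by
  refine IsHilbertSum.mk (fun m n hmn ζ η => ?_) ?_
  · rw [monomialEmbedding_apply, monomialEmbedding_apply, inner_smul_left (E := H2Tensor d r),
      inner_smul_right (E := H2Tensor d r), inner_zMonomial_tmul_of_ne hmn, mul_zero, mul_zero]
  · rw [top_le_iff, Submodule.topologicalClosure_eq_top_iff, Submodule.eq_bot_iff]
    intro x hx
    refine eq_zero_of_inner_zMonomial_tmul fun n ζ => ?_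
    have h := (Submodule.mem_orthogonal _ x).1 hx (monomialEmbedding r n ζ)
      (Submodule.mem_iSup_of_mem n ⟨ζ, rfl⟩)
    rw [monomialEmbedding_apply, inner_smul_left (E := H2Tensor d r)] at h
    refine (mul_eq_zero.1 h).resolve_left ?_
    simp [(Real.sqrt_pos.2 (weight_pos n)).ne']

/-! ### Invariant subspaces generated by monomials -/

/-- The space of all `ζ ∈ ℂ^r` with `z ^ n ⊗ ζ ∈ M`. -/
noncomputable def fiber {d r : ℕ} (M : ClosedSubmodule ℂ (H2Tensor d r)) (n : Fin d →₀ ℕ) :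
    Submodule ℂ (EuclideanSpace ℂ (Fin r)) :=
  M.toSubmodule.comap (TensorProduct.mk ℂ (H2 d) (EuclideanSpace ℂ (Fin r)) (zMonomial n))

lemma mem_fiber {d r : ℕ} {M : ClosedSubmodule ℂ (H2Tensor d r)} {n : Fin d →₀ ℕ}
    {ζ : EuclideanSpace ℂ (Fin r)} : ζ ∈ fiber M n ↔ zMonomial n ⊗ₜ[ℂ] ζ ∈ M := Iff.rfl

lemma fiber_le_fiber_add_single {d r : ℕ} {M : ClosedSubmodule ℂ (H2Tensor d r)}
    (hM : IsInvariant M) (n : Fin d →₀ ℕ) (k : Fin d) :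
    fiber M n ≤ fiber M (n + Finsupp.single k 1) := fun ζ hζ => by
  rw [mem_fiber, ← shift_zMonomial_tmul]
  exact hM k _ (mem_fiber.1 hζ)

lemma monotone_fiber {d r : ℕ} {M : ClosedSubmodule ℂ (H2Tensor d r)} (hM : IsInvariant M) :
    Monotone (fiber M) := by
  intro m n hmn
  obtain ⟨l, rfl⟩ := exists_add_of_le hmn
  clear hmn
  induction l using Finsupp.induction_linear generalizing m with
  | zero => rw [add_zero]
  | add l l' h h' =>
    rw [← add_assoc]
    exact h.trans (@h' _)
  | single k j =>
    induction j with
    | zero => simp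
    | succ j ih =>
      rw [Finsupp.single_add, ← add_assoc]
      exact ih.trans (fiber_le_fiber_add_single hM _ k)

/-- If `M` is generated by monomials, then `z ^ n ⊗ ζ` is orthogonal to `M` as soon as `ζ` is
orthogonal to `fiber M n`: the vectors orthogonal to all these `z ^ n ⊗ ζ` form a closed invariant
subspace that contains every monomial of `M`. -/
lemma inner_zMonomial_tmul_eq_zero {d r : ℕ} {M : ClosedSubmodule ℂ (H2Tensor d r)}
    {G : Set (H2Tensor d r)} (hG : ∀ x ∈ G, IsMonomial x) (hM : IsGeneratedBy M G)
    {n : Fin d →₀ ℕ} {ζ : EuclideanSpace ℂ (Fin r)} (hζ : ζ ∈ (fiber M n)ᗮ)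
    {x : H2Tensor d r} (hx : x ∈ M) : ⟪zMonomial n ⊗ₜ[ℂ] ζ, x⟫_ℂ = 0 := by
  let S : Submodule ℂ (H2Tensor d r) :=
    Submodule.span ℂ {y | ∃ m, ∃ η ∈ (fiber M m)ᗮ, y = zMonomial m ⊗ₜ[ℂ] η}
  let N : ClosedSubmodule ℂ (H2Tensor d r) := ⟨Sᗮ, S.isClosed_orthogonal⟩
  have hN : ∀ x, x ∈ N ↔ ∀ m, ∀ η ∈ (fiber M m)ᗮ, ⟪zMonomial m ⊗ₜ[ℂ] η, x⟫_ℂ = 0 := by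
    intro x
    change x ∈ Sᗮ ↔ _
    rw [Submodule.mem_orthogonal]
    refine ⟨fun h m η hη => h _ (Submodule.subset_span ⟨m, η, hη, rfl⟩), fun h u hu => ?_⟩
    induction hu using Submodule.span_induction with
    | mem u hu =>
      obtain ⟨m, η, hη, rfl⟩ := hu
      exact h m η hη
    | zero => exact inner_zero_left _
    | add u v _ _ hu hv => rw [inner_add_left, hu, hv, add_zero]
    | smul c u _ hu => rw [inner_smul_left, hu, mul_zero]
  refine (hN x).1 (hM.2 ⟨fun k y hy => ?_, fun g hg => ?_⟩ hx) n ζ hζ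
  · rw [hN] at hy ⊢
    intro m η hη
    rcases Nat.eq_zero_or_pos (m k) with h0 | hpos
    · exact inner_zMonomial_tmul_shift_eq_zero k h0 η y
    · obtain ⟨l, rfl⟩ : ∃ l, m = l + Finsupp.single k 1 :=
        ⟨m - Finsupp.single k 1,
          (tsub_add_cancel_of_le (by simpa [Nat.one_le_iff_ne_zero] using hpos.ne')).symm⟩
      have h1 := inner_zMonomial_add_single_tmul_shift k l η y
      rw [hy l η (Submodule.orthogonal_le (fiber_le_fiber_add_single hM.1.1 l k) hη),
        mul_zero] at h1
      exact (mul_eq_zero.1 h1).resolve_left (by exact_mod_cast (weight_pos l).ne')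
  · change g ∈ N
    rw [hN]
    intro m η hη
    obtain ⟨l, ξ, rfl⟩ := hG g hg
    rcases eq_or_ne m l with rfl | hml
    · have hξ : ξ ∈ fiber M m := hM.1.2 hg
      rw [TensorProduct.inner_tmul, Submodule.inner_left_of_mem_orthogonal hξ hη, mul_zero]
    · exact inner_zMonomial_tmul_of_ne hml η ξ

/-- The projection onto `M` is block diagonal. -/
lemma starProjection_zMonomial_tmul {d r : ℕ} {M : ClosedSubmodule ℂ (H2Tensor d r)}
    {G : Set (H2Tensor d r)} (hG : ∀ x ∈ G, IsMonomial x) (hM : IsGeneratedBy M G)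
    (n : Fin d →₀ ℕ) (ζ : EuclideanSpace ℂ (Fin r)) :
    M.toSubmodule.starProjection (zMonomial n ⊗ₜ[ℂ] ζ)
      = zMonomial n ⊗ₜ[ℂ] (fiber M n).starProjection ζ := by
  refine Submodule.eq_starProjection_of_mem_of_inner_eq_zero
    (mem_fiber.1 (Submodule.starProjection_apply_mem _ ζ)) fun x hx => ?_
  rw [← TensorProduct.tmul_sub]
  exact inner_zMonomial_tmul_eq_zero hG hM (Submodule.sub_starProjection_mem_orthogonal ζ) hx

/-! ### The commutator with the shift -/

/-- The orthogonal projection of `ℂ^r` onto the part of `fiber M (n + e_k)` orthogonal to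
`fiber M n`. -/
noncomputable def fiberJump {d r : ℕ} (M : ClosedSubmodule ℂ (H2Tensor d r)) (k : Fin d)
    (n : Fin d →₀ ℕ) : EuclideanSpace ℂ (Fin r) →L[ℂ] EuclideanSpace ℂ (Fin r) :=
  (fiber M (n + Finsupp.single k 1)).starProjection - (fiber M n).starProjection

open Classical in
/-- The singular value `‖z ^ (n + e_k)‖ / ‖z ^ n‖` that the block `n` contributes to the
commutator, set to zero if the block contributes none. -/
noncomputable def jumpWeight {d r : ℕ} (M : ClosedSubmodule ℂ (H2Tensor d r)) (k : Fin d)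
    (n : Fin d →₀ ℕ) : ℝ :=
  if fiberJump M k n = 0 then 0 else √(((n k : ℝ) + 1) / ((n.degree : ℝ) + 1))

lemma isStarProjection_fiberJump {d r : ℕ} {M : ClosedSubmodule ℂ (H2Tensor d r)}
    (hM : IsInvariant M) (k : Fin d) (n : Fin d →₀ ℕ) : IsStarProjection (fiberJump M k n) :=
  isStarProjection_starProjection.sub_of_mul_eq_left
    isStarProjection_starProjection
    (Submodule.starProjection_comp_starProjection_of_le (fiber_le_fiber_add_single hM n k))

lemma isBlockShift_commutator {d r : ℕ} {M : ClosedSubmodule ℂ (H2Tensor d r)}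
    {G : Set (H2Tensor d r)} (hG : ∀ x ∈ G, IsMonomial x) (hM : IsGeneratedBy M G) (k : Fin d) :
    IsBlockShift (monomialEmbedding r) (fun n => n + Finsupp.single k 1) (jumpWeight M k)
      (fiberJump M k) (M.toSubmodule.starProjection ∘L shift r k -
        shift r k ∘L M.toSubmodule.starProjection) where
  isHilbertSum := isHilbertSum_monomialEmbedding d r
  injective := add_single_injective k
  isStarProjection := isStarProjection_fiberJump hM.1.1 k
  nonneg n := by
    unfold jumpWeight
    split_ifs
    exacts [le_rfl, Real.sqrt_nonneg _]
  apply_block n ζ := by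
    have h1 : (M.toSubmodule.starProjection ∘L shift r k -
        shift r k ∘L M.toSubmodule.starProjection) (zMonomial n ⊗ₜ[ℂ] ζ)
        = zMonomial (n + Finsupp.single k 1) ⊗ₜ[ℂ] fiberJump M k n ζ := by
      rw [sub_apply, ContinuousLinearMap.comp_apply, ContinuousLinearMap.comp_apply,
        shift_zMonomial_tmul, starProjection_zMonomial_tmul hG hM,
        starProjection_zMonomial_tmul hG hM, shift_zMonomial_tmul, ← TensorProduct.tmul_sub]
      rfl
    rw [monomialEmbedding_apply, monomialEmbedding_apply, map_smul, h1]
    by_cases hQ : fiberJump M k n = 0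
    · simp [hQ]
    · have hw : √(weight n) ≠ 0 := (Real.sqrt_pos.2 (weight_pos n)).ne'
      have hc : √(((n k : ℝ) + 1) / ((n.degree : ℝ) + 1)) ≠ 0 :=
        (Real.sqrt_pos.2 (by positivity)).ne'
      have h2 : (√(weight n))⁻¹ = jumpWeight M k n * (√(weight (n + Finsupp.single k 1)))⁻¹ := by
        rw [jumpWeight, if_neg hQ, weight_add_single, Real.sqrt_mul (by positivity)]
        field_simp
      rw [smul_smul]
      congr 1
      exact_mod_cast h2

lemma summable_jumpWeight_rpow {d r : ℕ} {M : ClosedSubmodule ℂ (H2Tensor d r)}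
    (hM : IsInvariant M) (k : Fin d) {p : ℝ} (hp : 2 * (d : ℝ) < p) :
    Summable fun n => jumpWeight M k n ^ p := by
  have hp0 : 0 < p := lt_of_le_of_lt (by positivity) hp
  obtain ⟨N, hN⟩ := exists_bound_of_ne_add_single (monotone_fiber hM) k
  have hs := (summable_degree_add_one_rpow (d := d) (q := p / 2) (by linarith)).mul_left
    ((N : ℝ) ^ (p / 2))
  refine Summable.of_nonneg_of_le (fun n => ?_) (fun n => ?_) hs
  · unfold jumpWeight
    split_ifs <;> positivity
  · unfold jumpWeight
    split_ifs with hQ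
    · rw [Real.zero_rpow hp0.ne']
      positivity
    · have hn : (n k : ℝ) + 1 ≤ N := by
        exact_mod_cast hN n fun he => hQ (by simp only [fiberJump, he, sub_self])
      rw [Real.sqrt_eq_rpow, ← Real.rpow_mul (by positivity), one_div_mul_eq_div,
        Real.div_rpow (by positivity) (by positivity), Real.rpow_neg (by positivity),
        ← div_eq_mul_inv]
      gcongr

end DruryArveson

theorem mainTheorem1 (d r : ℕ) (M : ClosedSubmodule ℂ (DruryArveson.H2Tensor d r))
    (hM : ∃ G : Set (DruryArveson.H2Tensor d r),
      (∀ x ∈ G, DruryArveson.IsMonomial x) ∧ DruryArveson.IsGeneratedBy M G)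
    (p : ℝ) (hp : 2 * (d : ℝ) < p) (k : Fin d) :
    DruryArveson.MemSchatten p
      (M.toSubmodule.starProjection ∘L DruryArveson.shift r k -
        DruryArveson.shift r k ∘L M.toSubmodule.starProjection) := by
  obtain ⟨G, hG, hMG⟩ := hM
  exact (DruryArveson.isBlockShift_commutator hG hMG k).memSchatten
    (lt_of_le_of_lt (by positivity) hp) (DruryArveson.summable_jumpWeight_rpow hMG.1.1 k hp)
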